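/- Let $n\ge 2$ and $\lambda\in(1,n)$. Let $S^{n-1}$ be the unit sphere of $\mathbb R^n$, $d\xi$ its surface measure (of total mass $n|B^n|$), $\|\cdot\|$ the norm of $L^2(S^{n-1},d\xi)$, $B^n$ the closed unit ball, and $$\phi_\lambda(x)=\frac1{c_\lambda}|x|^{-(n-\lambda)},\qquad c_\lambda=2^\lambda\pi^{n/2}\,\frac{\Gamma(\lambda/2)}{\Gamma((n-\lambda)/2)}.$$ For a Lebesgue measurable set $A\subset\mathbb R^n$ with characteristic function $\mathcal X_A$, put $$\mathcal W(A)=\int_{\mathbb R^n}\!\int_{\mathbb R^n}\bigl(\mathcal X_{B^n}(x)-\mathcal X_A(x)\bigr)\bigl(\mathcal X_{B^n}(y)-\mathcal X_A(y)\bigr)\phi_\lambda(x-y)\,dy\,dx,$$ $$M_+(\xi)=\int_1^\infty \mathcal X_A(r\xi)\,r^{n-1}\,dr,\qquad M_-(\xi)=\int_0^1\bigl(1-\mathcal X_A(r\xi)\bigr)r^{n-1}\,dr\qquad(\xi\in S^{n-1}),$$ and, for a function $M$ on $S^{n-1}$, $$W(M)=\int_{S^{n-1}}\!\int_{S^{n-1}}M(\xi)M(\eta)\,\phi_\lambda(\xi-\eta)\,d\xi\,d\eta.$$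 For $\varepsilon>0$, let $\mathcal A_\varepsilon$ be the class of Lebesgue measurable sets $A\subset\mathbb R^n$ that contain the open ball of radius $e^{-\varepsilon}$ about the origin and are contained in the closed ball of radius $e^{\varepsilon}$ about the origin. **Proposition 5.1 (Projection to the sphere).** 1. For every $\varepsilon>0$ and $A\in\mathcal A_\varepsilon$, the functions $M_+,M_-$ lie in $L^2(S^{n-1})$, and the double integrals $\mathcal W(A)$ and $W(M_+-M_-)$ converge absolutely. 2. As $\varepsilon\to0^+$, uniformly in $A\in\mathcal A_\varepsilon$, $$\mathcal W(A)=W(M_+-M_-)+o(1)\bigl(\|M_+\|^2+\|M_-\|^2\bigr).$$ That is, for every $\delta>0$ there is an $\varepsilon_0>0$, depending only on $n$, $\lambda$ and $\delta$, such that for all $0<\varepsilon<\varepsilon_0$ and all $A\in\mathcal A_\varepsilon$, $$\bigl|\mathcal W(A)-W(M_+-M_-)\bigr|\le\delta\,\bigl(\|M_+\|^2+\|M_-\|^2\bigr).$$ 3. If $\lambda=2$ (so $n\ge3$; the Newton potential), the error is $O(\varepsilon)$: there are $C,\varepsilon_0>0$, depending only on $n$, such that for all $0<\varepsilon<\varepsilon_0$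 and all $A\in\mathcal A_\varepsilon$, $$\bigl|\mathcal W(A)-W(M_+-M_-)\bigr|\le C\,\varepsilon\,\bigl(\|M_+\|^2+\|M_-\|^2\bigr).$$ -/

import Mathlib

open MeasureTheory

noncomputable section

namespace RieszBall

/-- Euclidean space `ℝⁿ`. -/
abbrev E (n : ℕ) : Type := EuclideanSpace ℝ (Fin n)

/-- The unit sphere `S^{n-1}` of `ℝⁿ`. -/
abbrev Sph (n : ℕ) : Type := Metric.sphere (0 : E n) 1

/-- The surface measure `dξ` on `S^{n-1}`, of total mass `n |Bⁿ|`, for which Lebesgue measure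
is `r ^ (n - 1) dr dξ` in polar coordinates. -/
abbrev surf (n : ℕ) : Measure (Sph n) := (volume : Measure (E n)).toSphere

/-- The characteristic function of a set. -/
def chi {n : ℕ} (S : Set (E n)) : E n → ℝ := S.indicator (fun _ => 1)

/-- The normalizing constant
`c_lam = 2 ^ lam * π ^ (n / 2) * Γ(lam / 2) / Γ((n - lam) / 2)`. -/
def rieszConst (n : ℕ) (lam : ℝ) : ℝ :=
  2 ^ lam * Real.pi ^ ((n : ℝ) / 2) * Real.Gamma (lam / 2) / Real.Gamma (((n : ℝ) - lam) / 2)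

/-- The Riesz potential `φ_lam(x) = |x| ^ (-(n - lam)) / c_lam`. -/
def riesz (n : ℕ) (lam : ℝ) (x : E n) : ℝ :=
  1 / rieszConst n lam * ‖x‖ ^ (-((n : ℝ) - lam))

/-- `A` is a Lebesgue measurable set squeezed between the balls of radius `e ^ (-ε)` and `e ^ ε`
about the origin. The inner ball is open and the outer one closed, which is the weakest reading. -/
def Squeezed {n : ℕ} (ε : ℝ) (A : Set (E n)) : Prop :=
  NullMeasurableSet A volume ∧
    Metric.ball 0 (Real.exp (-ε)) ⊆ A ∧ A ⊆ Metric.closedBall 0 (Real.exp ε)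

/-- The integrand of the second variation. -/
def secondVarIntegrand {n : ℕ} (lam : ℝ) (A : Set (E n)) (x y : E n) : ℝ :=
  (chi (Metric.closedBall 0 1) x - chi A x) * (chi (Metric.closedBall 0 1) y - chi A y) *
    riesz n lam (x - y)

/-- The second variation `𝒲(A)` of the Riesz energy about the unit ball. -/
def secondVar {n : ℕ} (lam : ℝ) (A : Set (E n)) : ℝ :=
  ∫ x : E n, ∫ y : E n, secondVarIntegrand lam A x y

/-- The volume of `A` outside the unit ball in direction `ξ`. -/
def Mplus {n : ℕ} (A : Set (E n)) (ξ : Sph n) : ℝ :=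
  ∫ r in Set.Ioi (1 : ℝ), chi A (r • (ξ : E n)) * r ^ (n - 1)

/-- The volume of the complement of `A` inside the unit ball in direction `ξ`. -/
def Mminus {n : ℕ} (A : Set (E n)) (ξ : Sph n) : ℝ :=
  ∫ r in Set.Ioc (0 : ℝ) 1, (1 - chi A (r • (ξ : E n))) * r ^ (n - 1)

/-- The integrand of the spherical quadratic form. -/
def sphereFormIntegrand {n : ℕ} (lam : ℝ) (M : Sph n → ℝ) (ξ η : Sph n) : ℝ :=
  M ξ * M η * riesz n lam ((ξ : E n) - (η : E n))

/-- The spherical quadratic form `W(M) = ∬ M(ξ) M(η) φ_lam(ξ - η) dξ dη`. -/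
def sphereForm {n : ℕ} (lam : ℝ) (M : Sph n → ℝ) : ℝ :=
  ∫ ξ, ∫ η, sphereFormIntegrand lam M ξ η ∂(surf n) ∂(surf n)

/-- The `L²` norm on the sphere. -/
def sphereNorm {n : ℕ} (M : Sph n → ℝ) : ℝ :=
  Real.sqrt (∫ ξ, M ξ ^ 2 ∂(surf n))

end RieszBall

end

/-!
Write `u = χ_B - χ_A`. In polar coordinates `x = r ξ`, `y = s η` the second variation becomes the
integral of `u(r ξ) u(s η) φ(r ξ - s η)` against `r ^ (n - 1) dr dξ` and `s ^ (n - 1) ds dη`. Since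
`∫ u(r ξ) r ^ (n - 1) dr = M₋(ξ) - M₊(ξ)`, replacing `φ(r ξ - s η)` by `φ(ξ - η)` turns it into the
form `W(M₊ - M₋)` (`secondVar_eq`, `sphereForm_eq`). Only radii in `[e ^ (-ε), e ^ ε]` contribute,
and for these the identity `|r ξ - s η|² = (r - s)² + r s |ξ - η|²` shows that, with `d = |ξ - η|`
and `p = n - lam`, the two kernels differ by at most a constant times
`d ^ (-p) (ε + min 1 (ε² / d²))` (`abs_rpow_norm_sub_rpow_dist_le`).

This bound no longer contains the radii, and `∫ |u(r ξ)| r ^ (n - 1) dr = M₋(ξ) + M₊(ξ)`, so Schur's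
test (`lintegral_mul_mul_le`) reduces the error to the supremum over `ξ` of the integral of that
bound in `η`. A spherical cap of radius `t` has measure `O(t ^ (n - 1))` (`surf_cap_le`), so that by
the layer cake formula the integral over the sphere of a decreasing function of `d` is bounded by
the corresponding integral in `ℝ^{n-1}` (`lintegral_antitone_dist_le`). As `p < n - 1`, the kernel
`d ^ (-p)` has bounded integrals. The truncated kernel is at most `ε ^ a d ^ (-p - a)` for any
`a ∈ [0, 2]`, and a small `a > 0` gives the error `o(1)`; when `lam = 2` its integral is at most a
constant times `∫ min 1 (ε² / t²) dt = 2 ε`. The same argument applied to the kernels themselves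
gives absolute convergence for every `ε > 0`.
-/

noncomputable section

namespace RieszBall

open scoped Pointwise

/-! ### Polar coordinates -/

/-- The radial measure `r ^ (n - 1) dr` on `(0, ∞)`, as a measure on `ℝ`. -/
def radial (n : ℕ) : Measure ℝ :=
  (volume.restrict (Set.Ioi 0)).withDensity fun r => ENNReal.ofReal (r ^ (n - 1))

/-- The polar coordinate map `(ξ, r) ↦ r ξ`. -/
def polarMap (n : ℕ) (p : Sph n × ℝ) : E n := p.2 • (p.1 : E n)

lemma measurable_polarMap (n : ℕ) : Measurable (polarMap n) := by
  unfold polarMap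
  fun_prop

instance (n : ℕ) : SFinite (radial n) := by
  unfold radial
  infer_instance

lemma radial_eq_map (n : ℕ) :
    radial n = (Measure.volumeIoiPow (n - 1)).map Subtype.val := by
  have hm : MeasurableEmbedding (Subtype.val : Set.Ioi (0 : ℝ) → ℝ) :=
    MeasurableEmbedding.subtype_coe measurableSet_Ioi
  ext s hs
  rw [radial, Measure.volumeIoiPow, withDensity_apply _ hs, hm.map_apply,
    withDensity_apply _ (measurable_subtype_coe hs),
    setLIntegral_subtype measurableSet_Ioi _ fun a : ℝ ↦ ENNReal.ofReal (a ^ (n - 1)),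
    Measure.restrict_restrict hs, Subtype.image_preimage_coe, Set.inter_comm]

lemma measurePreserving_polarMap {n : ℕ} (hn : 1 ≤ n) :
    MeasurePreserving (polarMap n) ((surf n).prod (radial n)) volume := by
  refine ⟨measurable_polarMap n, ?_⟩
  have : Nonempty (Fin n) := ⟨⟨0, hn⟩⟩
  have : SFinite (Measure.volumeIoiPow (n - 1)) := inferInstance
  have h := (volume : Measure (E n)).measurePreserving_homeomorphUnitSphereProd
  rw [finrank_euclideanSpace_fin] at h
  have h1 : (surf n).prod (radial n) = ((surf n).prod (Measure.volumeIoiPow (n - 1))).map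
      (Prod.map id Subtype.val) := by
    rw [radial_eq_map, ← Measure.map_prod_map _ _ measurable_id measurable_subtype_coe,
      Measure.map_id]
  have h2 : polarMap n ∘ Prod.map id Subtype.val ∘ homeomorphUnitSphereProd (E n) =
      Subtype.val := by
    ext1 x
    exact congrArg Subtype.val ((homeomorphUnitSphereProd (E n)).symm_apply_apply x)
  rw [h1, ← h.map_eq, Measure.map_map (by fun_prop) (Homeomorph.measurable _),
    Measure.map_map (measurable_polarMap n) (by fun_prop), h2,
    (MeasurableEmbedding.subtype_coe (measurableSet_singleton _).compl).map_comap,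
    Subtype.range_coe, restrict_compl_singleton]

/-! ### Measure of spherical caps -/

/-- A spherical cap of radius `t` has measure `O(t ^ (n - 1))`: the cone over the cap lies in a
box with one side of length `2` along `ξ` and the other sides of length `2 t`. -/
lemma surf_cap_le {n : ℕ} (hn : 1 ≤ n) (ξ : Sph n) {t : ℝ} (ht : 0 ≤ t) :
    surf n {η | dist ξ η ≤ t} ≤ ENNReal.ofReal (n * 2 ^ n * t ^ (n - 1)) := by
  have hξ : ‖(ξ : E n)‖ = 1 := by simp
  let i₀ : Fin n := ⟨0, hn⟩
  obtain ⟨b, hb⟩ := Orthonormal.exists_orthonormalBasis_extension_of_card_eq (𝕜 := ℝ)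
    (E := E n) (ι := Fin n) (by simp) (v := fun _ => (ξ : E n)) (s := {i₀})
    ⟨fun _ => hξ, fun i j hij => (hij (Subsingleton.elim i j)).elim⟩
  replace hb : b i₀ = ξ := hb i₀ rfl
  let c : Fin n → ℝ := fun i => if i = i₀ then 1 else t
  let box : Set (Fin n → ℝ) := Set.pi Set.univ fun i => Set.Icc (-c i) (c i)
  have hsub : Set.Ioo (0 : ℝ) 1 • (Subtype.val '' {η : Sph n | dist ξ η ≤ t}) ⊆
      (fun x => WithLp.ofLp (b.repr x)) ⁻¹' box := by
    rintro _ ⟨r, hr, _, ⟨η, hη, rfl⟩, rfl⟩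
    have hη1 : ‖(η : E n)‖ = 1 := by simp
    intro i _
    change b.repr (r • (η : E n)) i ∈ Set.Icc (-c i) (c i)
    rw [Set.mem_Icc, ← abs_le, b.repr_apply_apply]
    simp only [inner_smul_right, abs_mul, abs_of_pos hr.1]
    by_cases hi : i = i₀
    · have h1 : |inner ℝ (b i) (η : E n)| ≤ 1 := by
        simpa [hη1] using abs_real_inner_le_norm (b i) (η : E n)
      simp only [c, hi, if_true] at h1 ⊢
      nlinarith [hr.1, hr.2]
    · have h0 : inner ℝ (b i) (ξ : E n) = 0 := by
        rw [← hb]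
        exact b.orthonormal.2 hi
      have h1 : |inner ℝ (b i) (η : E n)| ≤ t := by
        have h2 := abs_real_inner_le_norm (b i) ((η : E n) - ξ)
        rw [inner_sub_right, h0, sub_zero, b.norm_eq_one, one_mul, ← dist_eq_norm,
          dist_comm] at h2
        exact h2.trans hη
      simp only [c, hi, if_false]
      nlinarith [hr.1, hr.2, abs_nonneg (inner ℝ (b i) (η : E n))]
  have hvol : volume ((fun x => WithLp.ofLp (b.repr x)) ⁻¹' box) =
      ENNReal.ofReal (2 ^ n * t ^ (n - 1)) := by
    have hmp := (PiLp.volume_preserving_ofLp (Fin n)).comp b.repr.measurePreserving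
    have hbox : MeasurableSet box := MeasurableSet.univ_pi fun i => measurableSet_Icc
    have hc : ∀ i, 0 ≤ c i := fun i => by dsimp only [c]; split_ifs <;> linarith
    have := hmp.measure_preimage hbox.nullMeasurableSet
    refine this.trans ?_
    rw [volume_pi_pi]
    simp only [Real.volume_Icc]
    rw [← ENNReal.ofReal_prod_of_nonneg fun i _ => by linarith [hc i]]
    congr 1
    have : ∀ i, c i - -c i = 2 * c i := fun i => by ring
    simp only [this, Finset.prod_mul_distrib, c, Finset.prod_const, Finset.card_univ,
      Fintype.card_fin]
    rw [Finset.prod_ite, Finset.prod_const_one, Finset.prod_const, one_mul,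
      Finset.filter_ne', Finset.card_erase_of_mem (Finset.mem_univ _), Finset.card_univ,
      Fintype.card_fin]
  have hms : MeasurableSet {η : Sph n | dist ξ η ≤ t} :=
    measurableSet_le (by fun_prop) measurable_const
  rw [surf, Measure.toSphere_apply' _ hms, finrank_euclideanSpace_fin, mul_assoc,
    ENNReal.ofReal_mul (by positivity), ENNReal.ofReal_natCast]
  gcongr
  exact (measure_mono hsub).trans hvol.le

lemma lintegral_Ioo_pow (k : ℕ) {s : ℝ} (hs : 0 ≤ s) :
    ∫⁻ t in Set.Ioo 0 s, ENNReal.ofReal (t ^ k) = ENNReal.ofReal (s ^ (k + 1) / (k + 1)) := by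
  rw [Measure.restrict_congr_set Ioo_ae_eq_Ioc,
    ← ofReal_integral_eq_lintegral_ofReal (intervalIntegral.intervalIntegrable_pow _).1,
    ← intervalIntegral.integral_of_le hs]
  · simp
  · filter_upwards [ae_restrict_mem measurableSet_Ioc] with y hy
    exact pow_nonneg hy.1.le _

lemma dist_sphere_le_two {n : ℕ} (ξ η : Sph n) : dist ξ η ≤ 2 := by
  calc dist ξ η ≤ ‖(ξ : E n)‖ + ‖(η : E n)‖ := by
        rw [Subtype.dist_eq, dist_eq_norm]
        exact norm_sub_le _ _
    _ = 2 := by simp; norm_num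

/-- Integrals over the sphere of a decreasing function of the distance to a point are bounded by
radial integrals over `ℝ^{n-1}`: by the layer cake formula this reduces to the measure of caps. -/
lemma lintegral_antitone_dist_le {n : ℕ} (hn : 2 ≤ n) (ξ : Sph n) {g : ℝ → ℝ}
    (hg : AntitoneOn g (Set.Ioi 0)) (hg0 : ∀ t, 0 ≤ g t) (hgm : Measurable g) :
    ∫⁻ η, ENNReal.ofReal (g (dist ξ η)) ∂(surf n) ≤
      ENNReal.ofReal (n * 2 ^ n * (n - 1)) *
        ∫⁻ t in Set.Ioi 0, ENNReal.ofReal (t ^ (n - 2) * g t) := by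
  let ν : Measure ℝ := ENNReal.ofReal (n * 2 ^ n * (n - 1)) •
    (volume.restrict (Set.Ioi 0)).withDensity fun t => ENNReal.ofReal (t ^ (n - 2))
  have hν : ∫⁻ t, ENNReal.ofReal (g t) ∂ν = ENNReal.ofReal (n * 2 ^ n * (n - 1)) *
      ∫⁻ t in Set.Ioi 0, ENNReal.ofReal (t ^ (n - 2) * g t) := by
    rw [lintegral_smul_measure, lintegral_withDensity_eq_lintegral_mul _ (by fun_prop)
      (by fun_prop), smul_eq_mul]
    congr 1
    refine setLIntegral_congr_fun measurableSet_Ioi fun t (ht : 0 < t) => ?_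
    rw [Pi.mul_apply, ENNReal.ofReal_mul (by positivity)]
  rw [← hν, lintegral_eq_lintegral_meas_lt _ (.of_forall fun _ => hg0 _) (by fun_prop),
    lintegral_eq_lintegral_meas_lt _ (.of_forall hg0) (by fun_prop)]
  refine lintegral_mono fun a => ?_
  -- Distances on the sphere are at most `2`, so the superlevel set of `g` may be cut off there.
  let I : Set ℝ := {t | 0 < t ∧ t ≤ 2 ∧ a < g t}
  have hI : BddAbove I := ⟨2, fun t ht => ht.2.1⟩
  have hs : 0 ≤ sSup I := Real.sSup_nonneg fun t ht => ht.1.le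
  have hn' : ((n - 2 : ℕ) : ℝ) + 1 = n - 1 := by
    push_cast [Nat.cast_sub hn]
    ring
  have hn1 : (n : ℝ) - 1 ≠ 0 := by
    have : (2 : ℝ) ≤ n := by exact_mod_cast hn
    linarith
  calc surf n {η | a < g (dist ξ η)} ≤ surf n {η | dist ξ η ≤ sSup I} := by
        refine measure_mono fun η (hη : a < g (dist ξ η)) => ?_
        rcases (dist_nonneg (x := ξ) (y := η)).eq_or_lt with h0 | h0
        · exact h0.symm.trans_le hs
        · exact le_csSup hI ⟨h0, dist_sphere_le_two ξ η, hη⟩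
    _ ≤ ENNReal.ofReal (n * 2 ^ n * sSup I ^ (n - 1)) := surf_cap_le (by omega) ξ hs
    _ = ν (Set.Ioo 0 (sSup I)) := by
        rw [Measure.smul_apply, withDensity_apply _ measurableSet_Ioo,
          Measure.restrict_restrict measurableSet_Ioo,
          Set.inter_eq_left.mpr Set.Ioo_subset_Ioi_self, lintegral_Ioo_pow _ hs, smul_eq_mul,
          ← ENNReal.ofReal_mul (mul_nonneg (by positivity) (hn' ▸ by positivity)), hn',
          show n - 2 + 1 = n - 1 by omega]
        congr 1
        field_simp
    _ ≤ ν {t | a < g t} := by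
        refine measure_mono fun t ht => ?_
        obtain ⟨t', ht', htt'⟩ := exists_lt_of_lt_csSup
          (Set.nonempty_iff_ne_empty.mpr fun h => by simp [h] at ht) ht.2
        exact ht'.2.2.trans_le (hg ht.1 ht'.1 htt'.le)

/-! ### Singular integrals over the sphere -/

/-- The kernel `|ξ - η| ^ (-q)` is integrable over the sphere, uniformly in `ξ`, for `q < n - 1`. -/
lemma exists_lintegral_dist_rpow_le {n : ℕ} (hn : 2 ≤ n) {q : ℝ} (hq : 0 ≤ q) (hqn : q < n - 1) :
    ∃ C : ℝ, 0 ≤ C ∧ ∀ ξ : Sph n,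
      ∫⁻ η, ENNReal.ofReal (dist ξ η ^ (-q)) ∂(surf n) ≤ ENNReal.ofReal C := by
  -- The cutoff at the diameter of the sphere makes the radial integral converge at infinity.
  let g : ℝ → ℝ := (Set.Iic (2 : ℝ)).indicator fun t => |t| ^ (-q)
  have hg0 : ∀ t, 0 ≤ g t := fun t => Set.indicator_nonneg (fun t _ => by positivity) t
  have hg : AntitoneOn g (Set.Ioi 0) := by
    intro s (hs : 0 < s) t (ht : 0 < t) hst
    by_cases h2 : t ≤ 2
    · simp only [g, Set.indicator_of_mem (show t ∈ Set.Iic (2 : ℝ) from h2),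
        Set.indicator_of_mem (show s ∈ Set.Iic (2 : ℝ) from hst.trans h2), abs_of_pos hs,
        abs_of_pos ht]
      exact Real.rpow_le_rpow_of_nonpos hs hst (by linarith)
    · simp only [g, Set.indicator_of_notMem (show t ∉ Set.Iic (2 : ℝ) from h2)]
      exact hg0 s
  have hgm : Measurable g := by
    refine Measurable.indicator ?_ measurableSet_Iic
    fun_prop
  have hfin : ∫⁻ t in Set.Ioi 0, ENNReal.ofReal (t ^ (n - 2) * g t) < ⊤ := by
    have h1 : IntegrableOn (fun t : ℝ => t ^ ((n : ℝ) - 2 - q)) (Set.Ioc 0 2) :=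
      (intervalIntegral.intervalIntegrable_rpow' (by linarith)).1
    have h2 : ∫⁻ t in Set.Ioi 0, ENNReal.ofReal (t ^ (n - 2) * g t) =
        ∫⁻ t in Set.Ioc 0 2, ENNReal.ofReal (t ^ ((n : ℝ) - 2 - q)) := by
      rw [← Set.Ioi_inter_Iic, Set.inter_comm, ← Measure.restrict_restrict measurableSet_Iic,
        ← lintegral_indicator measurableSet_Iic]
      refine setLIntegral_congr_fun measurableSet_Ioi fun t (ht : 0 < t) => ?_
      by_cases h2 : t ∈ Set.Iic (2 : ℝ)
      · simp only [g, Set.indicator_of_mem h2, abs_of_pos ht]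
        rw [← Real.rpow_natCast, ← Real.rpow_add ht, Nat.cast_sub hn]
        rfl
      · simp only [g, Set.indicator_of_notMem h2, mul_zero, ENNReal.ofReal_zero]
    rw [h2]
    exact h1.lintegral_lt_top
  refine ⟨(ENNReal.ofReal (n * 2 ^ n * (n - 1)) *
    ∫⁻ t in Set.Ioi 0, ENNReal.ofReal (t ^ (n - 2) * g t)).toReal, ENNReal.toReal_nonneg,
    fun ξ => ?_⟩
  rw [ENNReal.ofReal_toReal (ENNReal.mul_ne_top ENNReal.ofReal_ne_top hfin.ne)]
  refine le_trans (le_of_eq ?_) (lintegral_antitone_dist_le hn ξ hg hg0 hgm)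
  congr 1 with η
  simp only [g, Set.indicator_of_mem (show dist ξ η ∈ Set.Iic (2 : ℝ) from dist_sphere_le_two ξ η),
    abs_of_nonneg dist_nonneg]

lemma setLIntegral_min_one_sq_div_le {ε : ℝ} (hε : 0 < ε) :
    ∫⁻ t in Set.Ioi (0 : ℝ), ENNReal.ofReal (min 1 (ε ^ 2 / t ^ 2)) ≤ ENNReal.ofReal (2 * ε) := by
  rw [← Set.Ioc_union_Ioi_eq_Ioi hε.le]
  refine (lintegral_union_le _ _ _).trans ?_
  rw [two_mul, ENNReal.ofReal_add hε.le hε.le]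
  gcongr
  · calc ∫⁻ t in Set.Ioc 0 ε, ENNReal.ofReal (min 1 (ε ^ 2 / t ^ 2))
        ≤ ∫⁻ t in Set.Ioc 0 ε, 1 := lintegral_mono fun t => by
          simp
      _ = ENNReal.ofReal ε := by simp
  · have hi : IntegrableOn (fun t : ℝ => ε ^ 2 * t ^ (-2 : ℝ)) (Set.Ioi ε) :=
      (integrableOn_Ioi_rpow_of_lt (by norm_num) hε).const_mul _
    calc ∫⁻ t in Set.Ioi ε, ENNReal.ofReal (min 1 (ε ^ 2 / t ^ 2))
        ≤ ∫⁻ t in Set.Ioi ε, ENNReal.ofReal (ε ^ 2 * t ^ (-2 : ℝ)) := by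
          refine setLIntegral_mono (by fun_prop) fun t (ht : ε < t) => ?_
          refine ENNReal.ofReal_le_ofReal ((min_le_right _ _).trans (le_of_eq ?_))
          rw [Real.rpow_neg (hε.trans ht).le, div_eq_mul_inv]
          norm_cast
      _ = ENNReal.ofReal ε := by
          rw [← ofReal_integral_eq_lintegral_ofReal hi, integral_const_mul,
            integral_Ioi_rpow_of_lt (by norm_num) hε]
          · congr 1
            norm_num
            rw [Real.rpow_neg hε.le, Real.rpow_one]
            field_simp
          · filter_upwards [ae_restrict_mem measurableSet_Ioi] with t ht
            have := hε.trans ht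
            positivity

/-- For the Newton kernel the truncated singular integral is of order `ε`. -/
lemma lintegral_dist_rpow_mul_min_le {n : ℕ} (hn : 2 ≤ n) {ε : ℝ} (hε : 0 < ε) (ξ : Sph n) :
    ∫⁻ η, ENNReal.ofReal (dist ξ η ^ (-((n : ℝ) - 2)) * min 1 (ε ^ 2 / dist ξ η ^ 2)) ∂(surf n) ≤
      ENNReal.ofReal (n * 2 ^ n * (n - 1) * (2 * ε)) := by
  have hn2 : (2 : ℝ) ≤ n := by exact_mod_cast hn
  let g : ℝ → ℝ := fun t => |t| ^ (-((n : ℝ) - 2)) * min 1 (ε ^ 2 / t ^ 2)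
  have hg0 : ∀ t, 0 ≤ g t := fun t => by positivity
  have hg : AntitoneOn g (Set.Ioi 0) := by
    intro s (hs : 0 < s) t (ht : 0 < t) hst
    dsimp only [g]
    rw [abs_of_pos hs, abs_of_pos ht]
    gcongr ?_ * min 1 (ε ^ 2 / ?_ ^ 2)
    exact Real.rpow_le_rpow_of_nonpos hs hst (by linarith)
  have h := lintegral_antitone_dist_le hn ξ hg hg0 (by fun_prop)
  simp only [g, abs_of_nonneg dist_nonneg] at h
  refine h.trans ?_
  rw [ENNReal.ofReal_mul (mul_nonneg (by positivity) (by linarith) : (0 : ℝ) ≤ n * 2 ^ n * (n - 1))]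
  refine mul_le_mul_right ?_ _
  refine le_trans (le_of_eq ?_) (setLIntegral_min_one_sq_div_le hε)
  refine setLIntegral_congr_fun measurableSet_Ioi fun t (ht : 0 < t) => ?_
  rw [abs_of_pos ht, ← mul_assoc, ← Real.rpow_natCast, ← Real.rpow_add ht, Nat.cast_sub hn]
  simp

/-! ### Comparison of the kernel with its restriction to the sphere -/

section Kernel

variable {n : ℕ}

lemma norm_smul_sub_smul_sq (ξ η : Sph n) (r s : ℝ) :
    ‖r • (ξ : E n) - s • (η : E n)‖ ^ 2 = (r - s) ^ 2 + r * s * dist ξ η ^ 2 := by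
  have h1 : ‖(ξ : E n)‖ = 1 := by simp
  have h2 : ‖(η : E n)‖ = 1 := by simp
  rw [Subtype.dist_eq, dist_eq_norm, norm_sub_sq_real, norm_sub_sq_real, norm_smul, norm_smul,
    real_inner_smul_left, real_inner_smul_right, h1, h2, Real.norm_eq_abs, Real.norm_eq_abs,
    mul_one, mul_one, sq_abs, sq_abs]
  ring

lemma exp_neg_mul_dist_le {ε r s : ℝ} (hr : Real.exp (-ε) ≤ r) (hs : Real.exp (-ε) ≤ s)
    (ξ η : Sph n) :
    Real.exp (-ε) * dist ξ η ≤ ‖r • (ξ : E n) - s • (η : E n)‖ := by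
  have h0 := Real.exp_pos (-ε)
  refine le_of_sq_le_sq ?_ (norm_nonneg _)
  rw [norm_smul_sub_smul_sq]
  have h1 : Real.exp (-ε) * Real.exp (-ε) ≤ r * s := mul_le_mul hr hs h0.le (h0.le.trans hr)
  nlinarith [mul_le_mul_of_nonneg_right h1 (sq_nonneg (dist ξ η)), sq_nonneg (r - s)]

lemma rpow_norm_smul_sub_smul_le {ε r s p : ℝ} (hp : 0 ≤ p) (hr : Real.exp (-ε) ≤ r)
    (hs : Real.exp (-ε) ≤ s) {ξ η : Sph n} (hξη : ξ ≠ η) :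
    ‖r • (ξ : E n) - s • (η : E n)‖ ^ (-p) ≤ Real.exp (p * ε) * dist ξ η ^ (-p) := by
  have hd : 0 < dist ξ η := dist_pos.mpr hξη
  calc ‖r • (ξ : E n) - s • (η : E n)‖ ^ (-p) ≤ (Real.exp (-ε) * dist ξ η) ^ (-p) :=
        Real.rpow_le_rpow_of_nonpos (by positivity) (exp_neg_mul_dist_le hr hs ξ η) (by linarith)
    _ = Real.exp (p * ε) * dist ξ η ^ (-p) := by
        rw [Real.mul_rpow (by positivity) hd.le, ← Real.exp_mul]
        ring_nf

lemma norm_smul_sub_smul_sq_le {ε r s : ℝ}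
    (hr : r ∈ Set.Icc (Real.exp (-ε)) (Real.exp ε)) (hs : s ∈ Set.Icc (Real.exp (-ε)) (Real.exp ε))
    (ξ η : Sph n) :
    ‖r • (ξ : E n) - s • (η : E n)‖ ^ 2 ≤ Real.exp (2 * ε) * (dist ξ η ^ 2 + 4 * ε ^ 2) := by
  have h1 : Real.exp (-ε) * Real.exp ε = 1 := by rw [← Real.exp_add]; simp
  have h2 : Real.exp (2 * ε) = Real.exp ε ^ 2 := by rw [← Real.exp_nat_mul]; norm_num
  have h0 := Real.exp_pos (-ε)
  have h3 : |r - s| ≤ Real.exp ε * (2 * ε) := by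
    have h4 : Real.exp ε - Real.exp (-ε) ≤ Real.exp ε * (2 * ε) := by
      have h5 := Real.add_one_le_exp (-(2 * ε))
      have h6 : Real.exp (-ε) = Real.exp ε * Real.exp (-(2 * ε)) := by
        rw [← Real.exp_add]; ring_nf
      nlinarith [Real.exp_pos ε]
    rw [abs_le]
    constructor <;> linarith [hr.1, hr.2, hs.1, hs.2]
  have h4 : (r - s) ^ 2 ≤ (Real.exp ε * (2 * ε)) ^ 2 := sq_le_sq' (abs_le.mp h3).1 (abs_le.mp h3).2
  have h5 : r * s ≤ Real.exp ε * Real.exp ε :=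
    mul_le_mul hr.2 hs.2 (h0.le.trans hs.1) (Real.exp_pos _).le
  rw [norm_smul_sub_smul_sq, h2]
  nlinarith [mul_le_mul_of_nonneg_right h5 (sq_nonneg (dist ξ η))]

/-- The relative difference of the kernels at `r ξ - s η` and `ξ - η` is of order `ε`, up to a term
that matters only where `|ξ - η|` is not large compared with `ε`. -/
lemma abs_rpow_norm_sub_rpow_dist_le {ε r s p : ℝ} (hp : 0 ≤ p) (hε : 0 ≤ ε) (hpε : p * ε ≤ 1)
    (hr : r ∈ Set.Icc (Real.exp (-ε)) (Real.exp ε)) (hs : s ∈ Set.Icc (Real.exp (-ε)) (Real.exp ε))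
    {ξ η : Sph n} (hξη : ξ ≠ η) :
    |‖r • (ξ : E n) - s • (η : E n)‖ ^ (-p) - dist ξ η ^ (-p)| ≤
      dist ξ η ^ (-p) * (2 * p * ε + (1 + 2 * p) * min 1 (ε ^ 2 / dist ξ η ^ 2)) := by
  have hd : 0 < dist ξ η := dist_pos.mpr hξη
  set d := dist ξ η with hd_def
  have hN : 0 < ‖r • (ξ : E n) - s • (η : E n)‖ :=
    lt_of_lt_of_le (by positivity) (exp_neg_mul_dist_le hr.1 hs.1 ξ η)
  have hup := rpow_norm_smul_sub_smul_le hp hr.1 hs.1 hξη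
  rw [← hd_def] at hup
  set N := ‖r • (ξ : E n) - s • (η : E n)‖
  have hD : 0 < d ^ (-p) := by positivity
  have hm : 0 ≤ min 1 (ε ^ 2 / d ^ 2) := by positivity
  set x := ε ^ 2 / d ^ 2 with hx
  have hx0 : 0 ≤ x := by positivity
  -- The lower bound comes from `(1 + 4 x) ^ (-p / 2) ≥ exp (-2 p x)`.
  have hlow : d ^ (-p) * Real.exp (-(p * ε + 2 * p * x)) ≤ N ^ (-p) := by
    have h1 : N ≤ d * Real.exp (ε + 2 * x) := by
      refine le_of_sq_le_sq ?_ (by positivity)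
      have h2 := norm_smul_sub_smul_sq_le hr hs ξ η
      have h3 : d ^ 2 + 4 * ε ^ 2 = d ^ 2 * (4 * x + 1) := by
        rw [hx]
        field_simp
        ring
      have h4 : (d * Real.exp (ε + 2 * x)) ^ 2 =
          Real.exp (2 * ε) * (d ^ 2 * Real.exp (4 * x)) := by
        rw [mul_pow, ← Real.exp_nat_mul, mul_left_comm, ← Real.exp_add]
        push_cast
        ring_nf
      rw [← hd_def, h3] at h2
      rw [h4]
      refine h2.trans ?_
      gcongr
      exact Real.add_one_le_exp _
    calc d ^ (-p) * Real.exp (-(p * ε + 2 * p * x)) = (d * Real.exp (ε + 2 * x)) ^ (-p) := by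
          rw [Real.mul_rpow hd.le (by positivity), ← Real.exp_mul]
          ring_nf
      _ ≤ N ^ (-p) := Real.rpow_le_rpow_of_nonpos hN h1 (by linarith)
  rw [abs_le]
  constructor
  · have h1 : 1 - (p * ε + (1 + 2 * p) * min 1 x) ≤ Real.exp (-(p * ε + 2 * p * x)) := by
      rcases le_total 1 x with h | h
      · rw [min_eq_left h]
        nlinarith [Real.exp_pos (-(p * ε + 2 * p * x)), mul_nonneg hp hε]
      · rw [min_eq_right h]
        nlinarith [Real.add_one_le_exp (-(p * ε + 2 * p * x))]
    nlinarith [mul_le_mul_of_nonneg_left h1 hD.le, mul_nonneg hp hε,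
      mul_nonneg hD.le (mul_nonneg hp hε)]
  · have h1 : Real.exp (p * ε) ≤ 1 + 2 * p * ε := by
      have h0 := mul_nonneg hp hε
      have := (abs_le.mp (Real.abs_exp_sub_one_sub_id_le (x := p * ε)
        (by rw [abs_of_nonneg h0]; exact hpε))).2
      nlinarith
    nlinarith [mul_le_mul_of_nonneg_left h1 hD.le,
      mul_nonneg hD.le (mul_nonneg (by linarith : 0 ≤ 1 + 2 * p) hm)]

lemma min_one_sq_le_rpow {y a : ℝ} (hy : 0 ≤ y) (ha : 0 ≤ a) (ha2 : a ≤ 2) :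
    min 1 (y ^ 2) ≤ y ^ a := by
  rcases hy.eq_or_lt with rfl | hy'
  · simpa using Real.rpow_nonneg le_rfl a
  rcases le_total 1 y with h | h
  · exact (min_le_left _ _).trans (Real.one_le_rpow h ha)
  · refine (min_le_right _ _).trans ?_
    rw [← Real.rpow_natCast]
    exact Real.rpow_le_rpow_of_exponent_ge hy' h (by exact_mod_cast ha2)

end Kernel

/-! ### Quadratic forms on a product space -/

section Schur

variable {X R : Type*} [MeasurableSpace X] [MeasurableSpace R] {σ : Measure X}
  {ρ : Measure R} [SFinite ρ]

lemma lintegral_prod_mul_fst {f : X × R → ENNReal} (hf : AEMeasurable f (σ.prod ρ))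
    {h : X → ENNReal} (hh : AEMeasurable h σ) :
    ∫⁻ p, f p * h p.1 ∂(σ.prod ρ) = ∫⁻ x, (∫⁻ r, f (x, r) ∂ρ) * h x ∂σ := by
  rw [lintegral_prod (fun p : X × R => f p * h p.1) (hf.mul hh.comp_fst)]
  refine lintegral_congr_ae ?_
  filter_upwards [hf.aestronglyMeasurable.prodMk_left] with x hx
  exact lintegral_mul_const'' _ hx.aemeasurable

variable [SFinite σ]

/-- Schur's test for a nonnegative symmetric kernel. -/
lemma lintegral_mul_mul_le {a : X → ENNReal} (ha : AEMeasurable a σ) {K : X → X → ENNReal}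
    (hK : Measurable (Function.uncurry K)) (hsymm : ∀ x y, K x y = K y x) {S : ENNReal}
    (hS : ∀ x, ∫⁻ y, K x y ∂σ ≤ S) :
    ∫⁻ x, ∫⁻ y, a x * a y * K x y ∂σ ∂σ ≤ 2 * S * ∫⁻ x, a x ^ 2 ∂σ := by
  have hab : ∀ b c : ENNReal, b * c ≤ b ^ 2 + c ^ 2 := by
    intro b c
    rcases le_total b c with h | h
    · calc b * c ≤ c * c := by gcongr
        _ ≤ b ^ 2 + c ^ 2 := by rw [← sq]; exact le_add_self
    · calc b * c ≤ b * b := by gcongr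
        _ ≤ b ^ 2 + c ^ 2 := by rw [← sq]; exact le_self_add
  have hKx : ∀ x, Measurable (K x) := fun x => hK.comp measurable_prodMk_left
  have h1 : ∫⁻ x, ∫⁻ y, a x ^ 2 * K x y ∂σ ∂σ ≤ S * ∫⁻ x, a x ^ 2 ∂σ := by
    rw [← lintegral_const_mul'' _ (ha.pow_const 2)]
    refine lintegral_mono fun x => ?_
    rw [lintegral_const_mul _ (hKx x), mul_comm]
    gcongr
    exact hS x
  have h2 : ∫⁻ x, ∫⁻ y, a y ^ 2 * K x y ∂σ ∂σ = ∫⁻ x, ∫⁻ y, a x ^ 2 * K x y ∂σ ∂σ := by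
    rw [lintegral_lintegral_swap]
    · simp only [hsymm]
    · exact (ha.comp_snd.pow_const 2).mul hK.aemeasurable
  calc ∫⁻ x, ∫⁻ y, a x * a y * K x y ∂σ ∂σ
      ≤ ∫⁻ x, ((∫⁻ y, a x ^ 2 * K x y ∂σ) + ∫⁻ y, a y ^ 2 * K x y ∂σ) ∂σ := by
        refine lintegral_mono fun x => ?_
        rw [← lintegral_add_left ((hKx x).const_mul _)]
        refine lintegral_mono fun y => ?_
        rw [← add_mul]
        gcongr
        exact hab _ _
    _ = (∫⁻ x, ∫⁻ y, a x ^ 2 * K x y ∂σ ∂σ) + ∫⁻ x, ∫⁻ y, a y ^ 2 * K x y ∂σ ∂σ := by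
        refine lintegral_add_left' ?_ _
        exact AEMeasurable.lintegral_prod_right' (f := fun z : X × X => a z.1 ^ 2 * K z.1 z.2)
          ((ha.comp_fst.pow_const 2).mul hK.aemeasurable)
    _ ≤ 2 * S * ∫⁻ x, a x ^ 2 ∂σ := by
        rw [h2, ← two_mul, mul_assoc]
        gcongr

/-- A quadratic form whose kernel ignores the second factor depends only on the marginal. -/
lemma lintegral_prod_prod_eq {f : X × R → ENNReal} (hf : AEMeasurable f (σ.prod ρ))
    {K : X → X → ENNReal} (hK : Measurable (Function.uncurry K)) :
    ∫⁻ z, f z.1 * f z.2 * K z.1.1 z.2.1 ∂((σ.prod ρ).prod (σ.prod ρ)) =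
      ∫⁻ x, ∫⁻ y, (∫⁻ r, f (x, r) ∂ρ) * (∫⁻ r, f (y, r) ∂ρ) * K x y ∂σ ∂σ := by
  have ha : AEMeasurable (fun x => ∫⁻ r, f (x, r) ∂ρ) σ := hf.lintegral_prod_right'
  have hh : AEMeasurable (fun x => ∫⁻ y, (∫⁻ r, f (y, r) ∂ρ) * K x y ∂σ) σ :=
    AEMeasurable.lintegral_prod_right'
      (f := fun z : X × X => (∫⁻ r, f (z.2, r) ∂ρ) * K z.1 z.2)
      (ha.comp_snd.mul hK.aemeasurable)
  have hK' : Measurable fun z : (X × R) × (X × R) => K z.1.1 z.2.1 :=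
    hK.comp (by fun_prop : Measurable fun z : (X × R) × (X × R) => (z.1.1, z.2.1))
  have hKx : ∀ x, Measurable (K x) := fun x => hK.comp measurable_prodMk_left
  rw [lintegral_prod (fun z : (X × R) × (X × R) => f z.1 * f z.2 * K z.1.1 z.2.1)
    ((hf.comp_fst.mul hf.comp_snd).mul hK'.aemeasurable)]
  calc ∫⁻ p, ∫⁻ q, f p * f q * K p.1 q.1 ∂(σ.prod ρ) ∂(σ.prod ρ)
      = ∫⁻ p, f p * ∫⁻ y, (∫⁻ r, f (y, r) ∂ρ) * K p.1 y ∂σ ∂(σ.prod ρ) := by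
        refine lintegral_congr fun p => ?_
        simp only [mul_assoc]
        rw [lintegral_const_mul'' (f := fun q : X × R => f q * K p.1 q.1) _
          (hf.mul ((hKx p.1).comp measurable_fst).aemeasurable),
          lintegral_prod_mul_fst hf (hKx p.1).aemeasurable]
    _ = _ := by
        rw [lintegral_prod_mul_fst hf hh]
        refine lintegral_congr fun x => ?_
        rw [← lintegral_const_mul'' (f := fun y => (∫⁻ r, f (y, r) ∂ρ) * K x y) _
          (ha.mul (hKx x).aemeasurable)]
        simp only [mul_assoc]

/-- The analogue of `lintegral_prod_prod_eq` for real-valued functions. The integrals of `v` over the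
second factor need not exist everywhere. -/
lemma integral_prod_prod_eq {v : X × R → ℝ} {k : X → X → ℝ}
    (hG : Integrable (fun z : (X × R) × (X × R) => v z.1 * v z.2 * k z.1.1 z.2.1)
      ((σ.prod ρ).prod (σ.prod ρ))) :
    ∫ z, v z.1 * v z.2 * k z.1.1 z.2.1 ∂((σ.prod ρ).prod (σ.prod ρ)) =
      ∫ x, ∫ y, (∫ r, v (x, r) ∂ρ) * (∫ r, v (y, r) ∂ρ) * k x y ∂σ ∂σ := by
  have hae : (fun p => ∫ q, v p * v q * k p.1 q.1 ∂(σ.prod ρ)) =ᵐ[σ.prod ρ]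
      fun p => v p * ∫ y, (∫ r, v (y, r) ∂ρ) * k p.1 y ∂σ := by
    filter_upwards [hG.prod_right_ae] with p hp
    -- Integrability of `q ↦ v q * k p.1 q.1` is known only where `v p ≠ 0`.
    by_cases h0 : v p = 0
    · simp [h0]
    · simp only [mul_assoc] at hp ⊢
      have hp' : Integrable (fun q => v q * k p.1 q.1) (σ.prod ρ) := by
        simpa [h0] using hp.const_mul (v p)⁻¹
      rw [integral_const_mul, integral_prod _ hp']
      simp only [integral_mul_const]
  have hint := hG.integral_prod_left.congr hae
  rw [integral_prod _ hG, integral_congr_ae hae, integral_prod _ hint]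
  simp only [integral_mul_const, mul_assoc, integral_const_mul]

end Schur

/-! ### The set in polar coordinates -/

section Polar

variable {n : ℕ}

/-- The difference `χ_B - χ_A` in polar coordinates. Negative `r` is allowed but carries no mass for
`radial n`. -/
def polarDiff (A : Set (E n)) (p : Sph n × ℝ) : ℝ :=
  chi (Metric.closedBall 0 1) (polarMap n p) - chi A (polarMap n p)

/-- The characteristic function of `A \ B` in polar coordinates. -/
def polarPlus (A : Set (E n)) (p : Sph n × ℝ) : ℝ :=
  (Set.Ioi (1 : ℝ)).indicator (fun r => chi A (r • (p.1 : E n))) p.2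

/-- The characteristic function of `B \ A` in polar coordinates. -/
def polarMinus (A : Set (E n)) (p : Sph n × ℝ) : ℝ :=
  (Set.Ioc (0 : ℝ) 1).indicator (fun r => 1 - chi A (r • (p.1 : E n))) p.2

lemma chi_nonneg (A : Set (E n)) (x : E n) : 0 ≤ chi A x :=
  Set.indicator_nonneg (fun _ _ => zero_le_one) x

lemma chi_le_one (A : Set (E n)) (x : E n) : chi A x ≤ 1 :=
  Set.indicator_le_self' (fun _ _ => zero_le_one) x

lemma polarPlus_nonneg (A : Set (E n)) (p : Sph n × ℝ) : 0 ≤ polarPlus A p :=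
  Set.indicator_nonneg (fun _ _ => chi_nonneg A _) _

lemma polarMinus_nonneg (A : Set (E n)) (p : Sph n × ℝ) : 0 ≤ polarMinus A p :=
  Set.indicator_nonneg (fun _ _ => sub_nonneg.mpr (chi_le_one A _)) _

lemma chi_closedBall_polarMap {p : Sph n × ℝ} (hp : 0 < p.2) :
    chi (Metric.closedBall 0 1) (polarMap n p) = if p.2 ≤ 1 then 1 else 0 := by
  classical
  rw [chi, Set.indicator_apply, mem_closedBall_zero_iff, polarMap, norm_smul]
  simp [abs_of_pos hp]

lemma polarDiff_eq_sub (A : Set (E n)) {p : Sph n × ℝ} (hp : 0 < p.2) :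
    polarDiff A p = polarMinus A p - polarPlus A p := by
  rw [polarDiff, chi_closedBall_polarMap hp, polarMinus, polarPlus, polarMap]
  by_cases h : p.2 ≤ 1 <;> simp [Set.indicator_apply, h, hp]

lemma abs_polarDiff_eq_add (A : Set (E n)) {p : Sph n × ℝ} (hp : 0 < p.2) :
    |polarDiff A p| = polarMinus A p + polarPlus A p := by
  rw [polarDiff_eq_sub A hp]
  by_cases h : p.2 ≤ 1
  · have h0 : polarPlus A p = 0 := by simp [polarPlus, h]
    rw [h0, sub_zero, add_zero, abs_of_nonneg (polarMinus_nonneg A p)]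
  · have h0 : polarMinus A p = 0 := by simp [polarMinus, h]
    rw [h0, zero_sub, zero_add, abs_neg, abs_of_nonneg (polarPlus_nonneg A p)]

lemma polarPlus_le {ε : ℝ} (hε : 0 < ε) {A : Set (E n)} (hA : Squeezed ε A) (p : Sph n × ℝ) :
    polarPlus A p ≤
      (Set.Icc (Real.exp (-ε)) (Real.exp ε)).indicator (fun _ => (1 : ℝ)) p.2 := by
  classical
  rw [polarPlus, Set.indicator_apply]
  split_ifs with h
  · have h1 : 1 < p.2 := h
    rw [chi, Set.indicator_apply]
    split_ifs with hmem
    · have h2 := hA.2.2 hmem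
      rw [mem_closedBall_zero_iff, norm_smul, Real.norm_eq_abs,
        abs_of_pos (zero_lt_one.trans h1)] at h2
      have h3 : Real.exp (-ε) ≤ 1 := Real.exp_le_one_iff.mpr (by linarith)
      rw [Set.indicator_of_mem]
      exact ⟨h3.trans h1.le, by simpa using h2⟩
    · exact Set.indicator_nonneg (fun _ _ => zero_le_one) _
  · exact Set.indicator_nonneg (fun _ _ => zero_le_one) _

lemma polarMinus_le {ε : ℝ} (hε : 0 < ε) {A : Set (E n)} (hA : Squeezed ε A) (p : Sph n × ℝ) :
    polarMinus A p ≤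
      (Set.Icc (Real.exp (-ε)) (Real.exp ε)).indicator (fun _ => (1 : ℝ)) p.2 := by
  classical
  rw [polarMinus, Set.indicator_apply]
  split_ifs with h
  · rw [chi, Set.indicator_apply]
    split_ifs with hmem
    · rw [sub_self]
      exact Set.indicator_nonneg (fun _ _ => zero_le_one) _
    · have h2 : ¬ p.2 < Real.exp (-ε) := fun hlt => hmem (hA.2.1 (by
        rw [mem_ball_zero_iff, norm_smul, Real.norm_eq_abs, abs_of_pos h.1]
        simpa using hlt))
      rw [Set.indicator_of_mem, sub_zero]
      exact ⟨not_lt.mp h2, h.2.trans (Real.one_le_exp hε.le)⟩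
  · exact Set.indicator_nonneg (fun _ _ => zero_le_one) _

lemma polarDiff_support {ε : ℝ} (hε : 0 < ε) {A : Set (E n)} (hA : Squeezed ε A) {p : Sph n × ℝ}
    (hp : 0 < p.2) (h : polarDiff A p ≠ 0) : p.2 ∈ Set.Icc (Real.exp (-ε)) (Real.exp ε) := by
  by_contra hmem
  have h1 := polarPlus_le hε hA p
  have h2 := polarMinus_le hε hA p
  rw [Set.indicator_of_notMem hmem] at h1 h2
  refine h ?_
  rw [polarDiff_eq_sub A hp, le_antisymm h1 (polarPlus_nonneg A p),
    le_antisymm h2 (polarMinus_nonneg A p), sub_zero]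

lemma ae_radial_pos (n : ℕ) : ∀ᵐ r ∂(radial n), 0 < r :=
  (withDensity_absolutelyContinuous _ _).ae_le (ae_restrict_mem measurableSet_Ioi)

lemma ae_polar_pos (n : ℕ) : ∀ᵐ p ∂((surf n).prod (radial n)), 0 < p.2 :=
  Measure.quasiMeasurePreserving_snd.ae (ae_radial_pos n)

lemma radial_Icc_lt_top (n : ℕ) (a b : ℝ) : radial n (Set.Icc a b) < ⊤ := by
  have h : IntegrableOn (fun r : ℝ => r ^ (n - 1)) (Set.Icc a b) :=
    (continuous_pow _).continuousOn.integrableOn_Icc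
  rw [radial, withDensity_apply _ measurableSet_Icc]
  refine lt_of_le_of_lt ?_ h.lintegral_lt_top
  exact lintegral_mono' (Measure.restrict_mono le_rfl Measure.restrict_le_self) le_rfl

lemma integrable_indicator_radial (n : ℕ) (a b : ℝ) :
    Integrable ((Set.Icc a b).indicator fun _ => (1 : ℝ)) (radial n) :=
  (integrable_indicator_iff measurableSet_Icc).mpr
    (integrableOn_const (radial_Icc_lt_top n a b).ne)

lemma integral_radial (n : ℕ) (f : ℝ → ℝ) :
    ∫ r, f r ∂(radial n) = ∫ r in Set.Ioi 0, f r * r ^ (n - 1) := by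
  have h := integral_withDensity_eq_integral_smul (μ := volume.restrict (Set.Ioi (0 : ℝ)))
    (f := fun r : ℝ => (r ^ (n - 1)).toNNReal) (by fun_prop) f
  refine h.trans (setIntegral_congr_fun measurableSet_Ioi fun r (hr : 0 < r) => ?_)
  simp only [NNReal.smul_def, smul_eq_mul]
  rw [Real.coe_toNNReal _ (by positivity), mul_comm]

/-- This holds for every `ξ`, also where the section of `A` along `ξ` is not measurable and both
integrals are zero by convention. -/
lemma Mplus_eq (A : Set (E n)) (ξ : Sph n) :
    Mplus A ξ = ∫ r, polarPlus A (ξ, r) ∂(radial n) := by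
  rw [integral_radial, Mplus,
    ← Set.inter_eq_left.mpr (Set.Ioi_subset_Ioi (zero_le_one' ℝ)), ← Measure.restrict_restrict
      measurableSet_Ioi, ← integral_indicator measurableSet_Ioi]
  congr 1 with r
  by_cases h : r ∈ Set.Ioi (1 : ℝ) <;> simp [polarPlus, Set.indicator, h]

lemma Mminus_eq (A : Set (E n)) (ξ : Sph n) :
    Mminus A ξ = ∫ r, polarMinus A (ξ, r) ∂(radial n) := by
  rw [integral_radial, Mminus,
    ← Set.inter_eq_left.mpr (Set.Ioc_subset_Ioi_self : Set.Ioc (0 : ℝ) 1 ⊆ Set.Ioi 0),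
    ← Measure.restrict_restrict measurableSet_Ioc, ← integral_indicator measurableSet_Ioc]
  congr 1 with r
  by_cases h : r ∈ Set.Ioc (0 : ℝ) 1 <;> simp [polarMinus, Set.indicator, h]

lemma aestronglyMeasurable_chi {A : Set (E n)} (hA : NullMeasurableSet A volume) :
    AEStronglyMeasurable (chi A) volume :=
  aestronglyMeasurable_const.indicator₀ hA

lemma aestronglyMeasurable_polarDiff (hn : 1 ≤ n) {A : Set (E n)}
    (hA : NullMeasurableSet A volume) :
    AEStronglyMeasurable (polarDiff A) ((surf n).prod (radial n)) :=
  ((aestronglyMeasurable_chi measurableSet_closedBall.nullMeasurableSet).sub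
    (aestronglyMeasurable_chi hA)).comp_measurePreserving (measurePreserving_polarMap hn)

lemma aestronglyMeasurable_polarPlus (hn : 1 ≤ n) {A : Set (E n)}
    (hA : NullMeasurableSet A volume) :
    AEStronglyMeasurable (polarPlus A) ((surf n).prod (radial n)) :=
  ((aestronglyMeasurable_chi hA).comp_measurePreserving (measurePreserving_polarMap hn)).indicator
    (measurableSet_Ioi.preimage measurable_snd)

lemma aestronglyMeasurable_polarMinus (hn : 1 ≤ n) {A : Set (E n)}
    (hA : NullMeasurableSet A volume) :
    AEStronglyMeasurable (polarMinus A) ((surf n).prod (radial n)) :=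
  (((aestronglyMeasurable_const (b := (1 : ℝ))).sub
    (aestronglyMeasurable_chi hA)).comp_measurePreserving (measurePreserving_polarMap hn)).indicator
    (measurableSet_Ioc.preimage measurable_snd)

lemma integrable_of_le_indicator {a b : ℝ} {f : Sph n × ℝ → ℝ}
    (hf : AEStronglyMeasurable f ((surf n).prod (radial n))) (h0 : ∀ p, 0 ≤ f p)
    (h : ∀ p, f p ≤ (Set.Icc a b).indicator (fun _ => (1 : ℝ)) p.2) :
    Integrable f ((surf n).prod (radial n)) :=
  ((integrable_indicator_radial n a b).comp_snd (surf n)).mono' hf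
    (.of_forall fun p => by rw [Real.norm_of_nonneg (h0 p)]; exact h p)

lemma memLp_integral_of_le_indicator {a b : ℝ} {f : Sph n × ℝ → ℝ}
    (hf : AEStronglyMeasurable f ((surf n).prod (radial n))) (h0 : ∀ p, 0 ≤ f p)
    (h : ∀ p, f p ≤ (Set.Icc a b).indicator (fun _ => (1 : ℝ)) p.2) :
    MemLp (fun ξ => ∫ r, f (ξ, r) ∂(radial n)) 2 (surf n) := by
  refine MemLp.of_bound hf.integral_prod_right'
    (∫ r, (Set.Icc a b).indicator (fun _ => (1 : ℝ)) r ∂(radial n)) (.of_forall fun ξ => ?_)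
  refine norm_integral_le_of_norm_le (integrable_indicator_radial n a b) (.of_forall fun r => ?_)
  rw [Real.norm_of_nonneg (h0 _)]
  exact h (ξ, r)

variable {ε : ℝ} {A : Set (E n)}

lemma memLp_Mplus (hn : 1 ≤ n) (hε : 0 < ε) (hA : Squeezed ε A) :
    MemLp (Mplus A) 2 (surf n) := by
  rw [funext (Mplus_eq A)]
  exact memLp_integral_of_le_indicator (aestronglyMeasurable_polarPlus hn hA.1)
    (polarPlus_nonneg A) (polarPlus_le hε hA)

lemma memLp_Mminus (hn : 1 ≤ n) (hε : 0 < ε) (hA : Squeezed ε A) :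
    MemLp (Mminus A) 2 (surf n) := by
  rw [funext (Mminus_eq A)]
  exact memLp_integral_of_le_indicator (aestronglyMeasurable_polarMinus hn hA.1)
    (polarMinus_nonneg A) (polarMinus_le hε hA)

lemma integrable_polarPlus (hn : 1 ≤ n) (hε : 0 < ε) (hA : Squeezed ε A) :
    Integrable (polarPlus A) ((surf n).prod (radial n)) :=
  integrable_of_le_indicator (aestronglyMeasurable_polarPlus hn hA.1) (polarPlus_nonneg A)
    (polarPlus_le hε hA)

lemma integrable_polarMinus (hn : 1 ≤ n) (hε : 0 < ε) (hA : Squeezed ε A) :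
    Integrable (polarMinus A) ((surf n).prod (radial n)) :=
  integrable_of_le_indicator (aestronglyMeasurable_polarMinus hn hA.1) (polarMinus_nonneg A)
    (polarMinus_le hε hA)

lemma integral_polarDiff_ae_eq (hn : 1 ≤ n) (hε : 0 < ε) (hA : Squeezed ε A) :
    (fun ξ => ∫ r, polarDiff A (ξ, r) ∂(radial n)) =ᵐ[surf n] fun ξ => Mminus A ξ - Mplus A ξ := by
  filter_upwards [(integrable_polarPlus hn hε hA).prod_right_ae,
    (integrable_polarMinus hn hε hA).prod_right_ae] with ξ h1 h2
  rw [Mplus_eq, Mminus_eq, ← integral_sub h2 h1]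
  refine integral_congr_ae ?_
  filter_upwards [ae_radial_pos n] with r hr
  exact polarDiff_eq_sub A (p := (ξ, r)) hr

lemma lintegral_polarDiff_ae_eq (hn : 1 ≤ n) (hε : 0 < ε) (hA : Squeezed ε A) :
    (fun ξ => ∫⁻ r, ‖polarDiff A (ξ, r)‖ₑ ∂(radial n)) =ᵐ[surf n]
      fun ξ => ENNReal.ofReal (Mminus A ξ + Mplus A ξ) := by
  filter_upwards [(integrable_polarPlus hn hε hA).prod_right_ae,
    (integrable_polarMinus hn hε hA).prod_right_ae] with ξ h1 h2
  rw [Mplus_eq, Mminus_eq, ← integral_add h2 h1, ofReal_integral_eq_lintegral_ofReal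
    (f := fun r => polarMinus A (ξ, r) + polarPlus A (ξ, r)) (h2.add h1)
    (.of_forall fun r => add_nonneg (polarMinus_nonneg A _) (polarPlus_nonneg A _))]
  refine lintegral_congr_ae ?_
  filter_upwards [ae_radial_pos n] with r hr
  rw [← abs_polarDiff_eq_add A (p := (ξ, r)) hr, Real.enorm_eq_ofReal_abs]

lemma sphereNorm_sq (M : Sph n → ℝ) : sphereNorm M ^ 2 = ∫ ξ, M ξ ^ 2 ∂(surf n) :=
  Real.sq_sqrt (integral_nonneg fun _ => sq_nonneg _)

lemma lintegral_sq_polarDiff_le (hn : 1 ≤ n) (hε : 0 < ε) (hA : Squeezed ε A) :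
    ∫⁻ ξ, (∫⁻ r, ‖polarDiff A (ξ, r)‖ₑ ∂(radial n)) ^ 2 ∂(surf n) ≤
      ENNReal.ofReal (2 * (sphereNorm (Mplus A) ^ 2 + sphereNorm (Mminus A) ^ 2)) := by
  have h1 := (memLp_Mplus hn hε hA).integrable_sq
  have h2 := (memLp_Mminus hn hε hA).integrable_sq
  have h0 : ∀ ξ, 0 ≤ Mminus A ξ + Mplus A ξ := fun ξ => by
    rw [Mplus_eq, Mminus_eq]
    exact add_nonneg (integral_nonneg fun _ => polarMinus_nonneg A _)
      (integral_nonneg fun _ => polarPlus_nonneg A _)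
  rw [sphereNorm_sq, sphereNorm_sq, ← integral_add h1 h2, ← integral_const_mul,
    ofReal_integral_eq_lintegral_ofReal
      (f := fun ξ => 2 * (Mplus A ξ ^ 2 + Mminus A ξ ^ 2)) ((h1.add h2).const_mul 2)
      (.of_forall fun ξ => by positivity)]
  refine lintegral_mono_ae ?_
  filter_upwards [lintegral_polarDiff_ae_eq hn hε hA] with ξ hξ
  rw [hξ, ← ENNReal.ofReal_pow (h0 ξ)]
  refine ENNReal.ofReal_le_ofReal ?_
  nlinarith [sq_nonneg (Mminus A ξ - Mplus A ξ)]

end Polar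

/-! ### Error estimate -/

section Error

variable {n : ℕ} {ε : ℝ} {A : Set (E n)}

lemma surf_singleton (hn : 2 ≤ n) (ξ : Sph n) : surf n {ξ} = 0 := by
  have h := surf_cap_le (by omega) ξ le_rfl
  rw [zero_pow (by omega), mul_zero, ENNReal.ofReal_zero] at h
  refine le_antisymm (le_trans (measure_mono ?_) h) zero_le
  rintro _ rfl
  simp

/-- The kernel bounds fail on the diagonal `ξ = η`, which is a null set as `n ≥ 2`. -/
lemma ae_fst_ne_fst (hn : 2 ≤ n) :
    ∀ᵐ z ∂(((surf n).prod (radial n)).prod ((surf n).prod (radial n))), z.1.1 ≠ z.2.1 := by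
  have hm : MeasurableSet {z : (Sph n × ℝ) × (Sph n × ℝ) | z.1.1 = z.2.1} :=
    measurableSet_eq_fun (by fun_prop) (by fun_prop)
  rw [ae_iff]
  simp only [ne_eq, not_not]
  rw [Measure.measure_prod_null hm]
  refine .of_forall fun p => ?_
  have : Prod.mk p ⁻¹' {z : (Sph n × ℝ) × (Sph n × ℝ) | z.1.1 = z.2.1} =
      {p.1} ×ˢ (Set.univ : Set ℝ) := by
    ext q
    simp [eq_comm]
  simp only [this, Measure.prod_prod, surf_singleton hn, zero_mul, Pi.zero_apply]

lemma lintegral_polarDiff_mul_kernel_le (hn : 1 ≤ n) (hε : 0 < ε) (hA : Squeezed ε A) {g : ℝ → ℝ}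
    (hg : Measurable g) {S : ℝ} (hS0 : 0 ≤ S)
    (hS : ∀ ξ, ∫⁻ η, ENNReal.ofReal (g (dist ξ η)) ∂(surf n) ≤ ENNReal.ofReal S) :
    ∫⁻ ξ, ∫⁻ η, (∫⁻ r, ‖polarDiff A (ξ, r)‖ₑ ∂(radial n)) *
        (∫⁻ r, ‖polarDiff A (η, r)‖ₑ ∂(radial n)) * ENNReal.ofReal (g (dist ξ η))
        ∂(surf n) ∂(surf n) ≤
      ENNReal.ofReal (4 * S * (sphereNorm (Mplus A) ^ 2 + sphereNorm (Mminus A) ^ 2)) := by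
  have hv := (aestronglyMeasurable_polarDiff hn hA.1).enorm
  refine (lintegral_mul_mul_le hv.lintegral_prod_right' (by fun_prop)
    (fun x y => by rw [dist_comm]) hS).trans ?_
  refine (mul_le_mul_right (lintegral_sq_polarDiff_le hn hε hA) _).trans (le_of_eq ?_)
  rw [← ENNReal.ofReal_ofNat 2, ← ENNReal.ofReal_mul (by norm_num),
    ← ENNReal.ofReal_mul (by positivity)]
  ring_nf

/-- A kernel that is dominated, for radii in the shell, by a function of the spherical distance
with bounded spherical integrals gives an absolutely convergent form, with a bound in terms of the
`L²` norms of `M₊` and `M₋`. -/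
lemma integrable_and_abs_integral_le (hn : 2 ≤ n) (hε : 0 < ε) (hA : Squeezed ε A) {g : ℝ → ℝ}
    (hg : Measurable g) {S : ℝ} (hS0 : 0 ≤ S)
    (hS : ∀ ξ, ∫⁻ η, ENNReal.ofReal (g (dist ξ η)) ∂(surf n) ≤ ENNReal.ofReal S)
    {k : (Sph n × ℝ) × (Sph n × ℝ) → ℝ} (hk : Measurable k)
    (hkg : ∀ z : (Sph n × ℝ) × (Sph n × ℝ), z.1.2 ∈ Set.Icc (Real.exp (-ε)) (Real.exp ε) →
      z.2.2 ∈ Set.Icc (Real.exp (-ε)) (Real.exp ε) → z.1.1 ≠ z.2.1 →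
        |k z| ≤ g (dist z.1.1 z.2.1)) :
    Integrable (fun z => polarDiff A z.1 * polarDiff A z.2 * k z)
        (((surf n).prod (radial n)).prod ((surf n).prod (radial n))) ∧
      |∫ z, polarDiff A z.1 * polarDiff A z.2 * k z
        ∂(((surf n).prod (radial n)).prod ((surf n).prod (radial n)))| ≤
        4 * S * (sphereNorm (Mplus A) ^ 2 + sphereNorm (Mminus A) ^ 2) := by
  have hv := aestronglyMeasurable_polarDiff (by omega : 1 ≤ n) hA.1
  have hle : ∫⁻ z, ‖polarDiff A z.1 * polarDiff A z.2 * k z‖ₑ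
      ∂(((surf n).prod (radial n)).prod ((surf n).prod (radial n))) ≤
      ENNReal.ofReal (4 * S * (sphereNorm (Mplus A) ^ 2 + sphereNorm (Mminus A) ^ 2)) := by
    refine le_trans ?_ (lintegral_polarDiff_mul_kernel_le (by omega) hε hA hg hS0 hS)
    rw [← lintegral_prod_prod_eq (f := fun p => ‖polarDiff A p‖ₑ) hv.enorm
      (K := fun ξ η => ENNReal.ofReal (g (dist ξ η))) (by fun_prop)]
    refine lintegral_mono_ae ?_
    filter_upwards [ae_fst_ne_fst hn, Measure.quasiMeasurePreserving_fst.ae (ae_polar_pos n),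
      Measure.quasiMeasurePreserving_snd.ae (ae_polar_pos n)] with z hz h1 h2
    rw [enorm_mul, enorm_mul]
    by_cases hv1 : polarDiff A z.1 = 0
    · simp [hv1]
    by_cases hv2 : polarDiff A z.2 = 0
    · simp [hv2]
    gcongr
    rw [Real.enorm_eq_ofReal_abs]
    exact ENNReal.ofReal_le_ofReal
      (hkg z (polarDiff_support hε hA h1 hv1) (polarDiff_support hε hA h2 hv2) hz)
  refine ⟨⟨(hv.comp_fst.mul hv.comp_snd).mul hk.aestronglyMeasurable,
    hle.trans_lt ENNReal.ofReal_lt_top⟩, ?_⟩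
  rw [← Real.norm_eq_abs]
  have h0 : 0 ≤ 4 * S * (sphereNorm (Mplus A) ^ 2 + sphereNorm (Mminus A) ^ 2) := by positivity
  rw [← ENNReal.ofReal_le_ofReal_iff h0, ofReal_norm]
  exact (enorm_integral_le_lintegral_enorm _).trans hle

lemma rieszConst_pos {lam : ℝ} (h0 : 0 < lam) (h1 : lam < n) : 0 < rieszConst n lam := by
  have := Real.Gamma_pos_of_pos (s := lam / 2) (by linarith)
  have := Real.Gamma_pos_of_pos (s := ((n : ℝ) - lam) / 2) (by linarith)
  have := Real.pi_pos
  unfold rieszConst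
  positivity

lemma measurable_riesz (n : ℕ) (lam : ℝ) : Measurable (riesz n lam) := by
  unfold riesz
  fun_prop

lemma aestronglyMeasurable_secondVarIntegrand (lam : ℝ) (hA : NullMeasurableSet A volume) :
    AEStronglyMeasurable (fun p : E n × E n => secondVarIntegrand lam A p.1 p.2)
      (volume.prod volume) := by
  have hu := (aestronglyMeasurable_chi
    (Metric.isClosed_closedBall (x := (0 : E n)) (ε := 1)).nullMeasurableSet).sub
    (aestronglyMeasurable_chi hA)
  exact (hu.comp_fst.mul hu.comp_snd).mul
    ((measurable_riesz n lam).comp (measurable_fst.sub measurable_snd)).aestronglyMeasurable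

lemma measurePreserving_polarMap_prod (hn : 1 ≤ n) :
    MeasurePreserving (Prod.map (polarMap n) (polarMap n))
      (((surf n).prod (radial n)).prod ((surf n).prod (radial n))) (volume.prod volume) :=
  (measurePreserving_polarMap hn).prod (measurePreserving_polarMap hn)

lemma integrable_secondVarIntegrand_iff (hn : 1 ≤ n) (lam : ℝ) (hA : NullMeasurableSet A volume) :
    Integrable (fun p : E n × E n => secondVarIntegrand lam A p.1 p.2) (volume.prod volume) ↔
      Integrable (fun z => polarDiff A z.1 * polarDiff A z.2 *
          riesz n lam (polarMap n z.1 - polarMap n z.2))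
        (((surf n).prod (radial n)).prod ((surf n).prod (radial n))) :=
  ((measurePreserving_polarMap_prod hn).integrable_comp
    (aestronglyMeasurable_secondVarIntegrand lam hA)).symm

lemma secondVar_eq (hn : 1 ≤ n) {lam : ℝ} (hA : NullMeasurableSet A volume)
    (hint : Integrable (fun p : E n × E n => secondVarIntegrand lam A p.1 p.2)
      (volume.prod volume)) :
    secondVar lam A = ∫ z, polarDiff A z.1 * polarDiff A z.2 *
      riesz n lam (polarMap n z.1 - polarMap n z.2)
        ∂(((surf n).prod (radial n)).prod ((surf n).prod (radial n))) := by
  have hmp := measurePreserving_polarMap_prod hn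
  rw [secondVar, ← integral_prod _ hint, ← hmp.map_eq, integral_map hmp.aemeasurable]
  · rfl
  · rw [hmp.map_eq]
    exact aestronglyMeasurable_secondVarIntegrand lam hA

lemma sphereForm_eq (hn : 1 ≤ n) (hε : 0 < ε) (hA : Squeezed ε A) {lam : ℝ}
    (hint : Integrable (fun z => polarDiff A z.1 * polarDiff A z.2 *
      riesz n lam ((z.1.1 : E n) - (z.2.1 : E n)))
      (((surf n).prod (radial n)).prod ((surf n).prod (radial n)))) :
    sphereForm lam (Mplus A - Mminus A) = ∫ z, polarDiff A z.1 * polarDiff A z.2 *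
      riesz n lam ((z.1.1 : E n) - (z.2.1 : E n))
        ∂(((surf n).prod (radial n)).prod ((surf n).prod (radial n))) := by
  rw [integral_prod_prod_eq (k := fun ξ η : Sph n => riesz n lam ((ξ : E n) - (η : E n))) hint,
    sphereForm]
  have hm := integral_polarDiff_ae_eq hn hε hA
  refine integral_congr_ae ?_
  filter_upwards [hm] with ξ hξ
  refine integral_congr_ae ?_
  filter_upwards [hm] with η hη
  rw [hξ, hη, sphereFormIntegrand, Pi.sub_apply, Pi.sub_apply]
  ring

lemma riesz_sphere (lam : ℝ) (ξ η : Sph n) :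
    riesz n lam ((ξ : E n) - (η : E n)) =
      1 / rieszConst n lam * dist ξ η ^ (-((n : ℝ) - lam)) := by
  rw [riesz, Subtype.dist_eq, dist_eq_norm]

lemma lintegral_ofReal_const_mul_le {S : ℝ} {g : ℝ → ℝ} (hg : Measurable g) {ξ : Sph n}
    (hS : ∫⁻ η, ENNReal.ofReal (g (dist ξ η)) ∂(surf n) ≤ ENNReal.ofReal S) {c : ℝ} (hc : 0 ≤ c) :
    ∫⁻ η, ENNReal.ofReal (c * g (dist ξ η)) ∂(surf n) ≤ ENNReal.ofReal (c * S) := by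
  simp only [ENNReal.ofReal_mul hc]
  rw [lintegral_const_mul _ (by fun_prop)]
  gcongr

lemma integrable_forms (hn : 2 ≤ n) {lam : ℝ} (hlam : 1 < lam) (hlam' : lam < n) (hε : 0 < ε)
    (hA : Squeezed ε A) :
    Integrable (fun z => polarDiff A z.1 * polarDiff A z.2 *
        riesz n lam (polarMap n z.1 - polarMap n z.2))
        (((surf n).prod (radial n)).prod ((surf n).prod (radial n))) ∧
      Integrable (fun z => polarDiff A z.1 * polarDiff A z.2 *
        riesz n lam ((z.1.1 : E n) - (z.2.1 : E n)))
        (((surf n).prod (radial n)).prod ((surf n).prod (radial n))) := by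
  have hc := rieszConst_pos (by linarith) hlam'
  obtain ⟨C, hC0, hC⟩ := exists_lintegral_dist_rpow_le hn (q := n - lam) (by linarith)
    (by linarith)
  have hp : 0 ≤ (n : ℝ) - lam := by linarith
  have hg : Measurable fun t : ℝ => t ^ (-((n : ℝ) - lam)) := by fun_prop
  constructor
  · refine (integrable_and_abs_integral_le hn hε hA
      (g := fun t => 1 / rieszConst n lam * Real.exp ((n - lam) * ε) * t ^ (-((n : ℝ) - lam)))
      (by fun_prop) (by positivity)
      (fun ξ => lintegral_ofReal_const_mul_le hg (hC ξ) (by positivity)) ?_ ?_).1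
    · exact (measurable_riesz n lam).comp (((measurable_polarMap n).comp measurable_fst).sub
        ((measurable_polarMap n).comp measurable_snd))
    · intro z h1 h2 hz
      rw [riesz, abs_of_nonneg (by positivity), mul_assoc]
      exact mul_le_mul_of_nonneg_left (rpow_norm_smul_sub_smul_le hp h1.1 h2.1 hz) (by positivity)
  · refine (integrable_and_abs_integral_le hn hε hA
      (g := fun t => 1 / rieszConst n lam * t ^ (-((n : ℝ) - lam)))
      (by fun_prop) (by positivity)
      (fun ξ => lintegral_ofReal_const_mul_le hg (hC ξ) (by positivity)) ?_ ?_).1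
    · exact (measurable_riesz n lam).comp (by fun_prop)
    · intro z _ _ _
      rw [riesz_sphere, abs_of_nonneg (by positivity)]

lemma integrable_sphereFormIntegrand (hn : 2 ≤ n) {lam : ℝ} (hlam : 1 < lam) (hlam' : lam < n)
    (hε : 0 < ε) (hA : Squeezed ε A) :
    Integrable (fun p : Sph n × Sph n => sphereFormIntegrand lam (Mplus A - Mminus A) p.1 p.2)
      ((surf n).prod (surf n)) := by
  have hc := rieszConst_pos (by linarith) hlam'
  obtain ⟨C, hC0, hC⟩ := exists_lintegral_dist_rpow_le hn (q := n - lam) (by linarith)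
    (by linarith)
  have hM := (memLp_Mplus (by omega) hε hA).1.sub (memLp_Mminus (by omega) hε hA).1
  have hm := integral_polarDiff_ae_eq (by omega) hε hA
  have hle : ∀ᵐ ξ ∂(surf n), ‖(Mplus A - Mminus A) ξ‖ₑ ≤
      ∫⁻ r, ‖polarDiff A (ξ, r)‖ₑ ∂(radial n) := by
    filter_upwards [hm] with ξ hξ
    rw [Pi.sub_apply, enorm_sub_rev, ← hξ]
    exact enorm_integral_le_lintegral_enorm _
  have hk : AEStronglyMeasurable
      (fun p : Sph n × Sph n => sphereFormIntegrand lam (Mplus A - Mminus A) p.1 p.2)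
      ((surf n).prod (surf n)) :=
    (hM.comp_fst.mul hM.comp_snd).mul
      (Measurable.aestronglyMeasurable ((measurable_riesz n lam).comp (by fun_prop)))
  refine ⟨hk, lt_of_le_of_lt ?_ ((lintegral_polarDiff_mul_kernel_le (by omega) hε hA
    (g := fun t => 1 / rieszConst n lam * t ^ (-((n : ℝ) - lam))) (by fun_prop)
    (mul_nonneg (by positivity) hC0) (fun ξ => lintegral_ofReal_const_mul_le
      (g := fun t => t ^ (-((n : ℝ) - lam))) (by fun_prop) (hC ξ)
      (by positivity : 0 ≤ 1 / rieszConst n lam))).trans_lt ENNReal.ofReal_lt_top)⟩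
  rw [lintegral_prod _ hk.enorm]
  refine lintegral_mono_ae ?_
  filter_upwards [hle] with ξ hξ
  refine lintegral_mono_ae ?_
  filter_upwards [hle] with η hη
  rw [sphereFormIntegrand, enorm_mul, enorm_mul, riesz_sphere, Real.enorm_eq_ofReal_abs (1 / _ * _),
    abs_of_nonneg (by positivity)]
  gcongr

/-- The error is controlled by the spherical integral of the Riesz kernel, cut off by the factor
`min 1 (ε ^ 2 / |ξ - η| ^ 2)`, up to an additional term of order `ε`. -/
lemma exists_abs_secondVar_sub_sphereForm_le (hn : 2 ≤ n) {lam : ℝ} (hlam : 1 < lam)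
    (hlam' : lam < n) :
    ∃ C₁ C₂ : ℝ, 0 ≤ C₁ ∧ 0 ≤ C₂ ∧ ∀ ε : ℝ, 0 < ε → (n - lam) * ε ≤ 1 → ∀ S : ℝ, 0 ≤ S →
      (∀ ξ : Sph n, ∫⁻ η, ENNReal.ofReal
        (dist ξ η ^ (-((n : ℝ) - lam)) * min 1 (ε ^ 2 / dist ξ η ^ 2)) ∂(surf n) ≤
          ENNReal.ofReal S) →
      ∀ A : Set (E n), Squeezed ε A →
        |secondVar lam A - sphereForm lam (Mplus A - Mminus A)| ≤
          (C₁ * ε + C₂ * S) * (sphereNorm (Mplus A) ^ 2 + sphereNorm (Mminus A) ^ 2) := by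
  have hc := rieszConst_pos (by linarith) hlam'
  obtain ⟨C, hC0, hC⟩ := exists_lintegral_dist_rpow_le hn (q := n - lam) (by linarith)
    (by linarith)
  have hp : 0 < (n : ℝ) - lam := by linarith
  set p : ℝ := n - lam
  set c : ℝ := 1 / rieszConst n lam with hcdef
  have hc0 : 0 < c := by positivity
  refine ⟨4 * (c * (2 * p) * C), 4 * (c * (1 + 2 * p)), by positivity, by positivity,
    fun ε hε hpε S hS0 hS A hA => ?_⟩
  obtain ⟨h1, h2⟩ := integrable_forms hn hlam hlam' hε hA
  have h3 := (integrable_secondVarIntegrand_iff (by omega) lam hA.1).mpr h1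
  rw [secondVar_eq (by omega) hA.1 h3, sphereForm_eq (by omega) hε hA h2, ← integral_sub h1 h2]
  simp only [← mul_sub]
  let g : ℝ → ℝ := fun t =>
    c * (2 * p * ε) * t ^ (-p) + c * (1 + 2 * p) * (t ^ (-p) * min 1 (ε ^ 2 / t ^ 2))
  have hgS : ∀ ξ : Sph n, ∫⁻ η, ENNReal.ofReal (g (dist ξ η)) ∂(surf n) ≤
      ENNReal.ofReal (c * (2 * p * ε) * C + c * (1 + 2 * p) * S) := by
    intro ξ
    rw [ENNReal.ofReal_add (by positivity) (by positivity)]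
    refine le_trans ?_ (add_le_add
      (lintegral_ofReal_const_mul_le (g := fun t => t ^ (-p)) (by fun_prop) (hC ξ)
        (by positivity : 0 ≤ c * (2 * p * ε)))
      (lintegral_ofReal_const_mul_le (g := fun t => t ^ (-p) * min 1 (ε ^ 2 / t ^ 2))
        (by fun_prop) (hS ξ) (by positivity : 0 ≤ c * (1 + 2 * p))))
    rw [← lintegral_add_left (by fun_prop)]
    exact lintegral_mono fun η => ENNReal.ofReal_add_le
  refine (integrable_and_abs_integral_le hn hε hA (g := g) (by fun_prop) (by positivity) hgS
    (k := fun z => riesz n lam (polarMap n z.1 - polarMap n z.2) -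
      riesz n lam ((z.1.1 : E n) - (z.2.1 : E n))) ?_ ?_).2.trans (le_of_eq (by ring))
  · exact ((measurable_riesz n lam).comp (((measurable_polarMap n).comp measurable_fst).sub
      ((measurable_polarMap n).comp measurable_snd))).sub
      ((measurable_riesz n lam).comp (by fun_prop))
  · intro z hz1 hz2 hz
    rw [riesz_sphere, riesz, ← mul_sub, abs_mul, ← hcdef, abs_of_pos hc0]
    refine (mul_le_mul_of_nonneg_left
      (abs_rpow_norm_sub_rpow_dist_le hp.le hε.le hpε hz1 hz2 hz) hc0.le).trans (le_of_eq ?_)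
    simp only [g]
    ring

end Error

end RieszBall

end

open RieszBall in
theorem proposition5p1 (n : ℕ) (hn : 2 ≤ n) (lam : ℝ) (hlam : 1 < lam) (hlam' : lam < n) :
    -- All integrals involved converge absolutely.
    (∀ ε : ℝ, 0 < ε → ∀ A : Set (E n), Squeezed ε A →
      Integrable (fun p : E n × E n => secondVarIntegrand lam A p.1 p.2)
        (volume.prod volume) ∧
      MemLp (Mplus A) 2 (surf n) ∧ MemLp (Mminus A) 2 (surf n) ∧
      Integrable (fun p : Sph n × Sph n => sphereFormIntegrand lam (Mplus A - Mminus A) p.1 p.2)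
        ((surf n).prod (surf n))) ∧
    -- The error is `o(1)` relative to the squared norms, uniformly in `A`.
    (∀ δ : ℝ, 0 < δ → ∃ ε₀ : ℝ, 0 < ε₀ ∧ ∀ ε : ℝ, 0 < ε → ε < ε₀ →
      ∀ A : Set (E n), Squeezed ε A →
        |secondVar lam A - sphereForm lam (Mplus A - Mminus A)| ≤
          δ * (sphereNorm (Mplus A) ^ 2 + sphereNorm (Mminus A) ^ 2)) ∧
    -- For the Newton potential it is `O(ε)`.
    (lam = 2 → ∃ C ε₀ : ℝ, 0 < C ∧ 0 < ε₀ ∧ ∀ ε : ℝ, 0 < ε → ε < ε₀ →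
      ∀ A : Set (E n), Squeezed ε A →
        |secondVar lam A - sphereForm lam (Mplus A - Mminus A)| ≤
          C * ε * (sphereNorm (Mplus A) ^ 2 + sphereNorm (Mminus A) ^ 2)) := by
  have hp : 0 < (n : ℝ) - lam := by linarith
  obtain ⟨C₁, C₂, hC₁, hC₂, herr⟩ := exists_abs_secondVar_sub_sphereForm_le hn hlam hlam'
  have hsmall : ∀ ε : ℝ, ε < 1 / (n - lam) → (n - lam) * ε ≤ 1 := fun ε h => by
    rw [lt_div_iff₀ hp] at h
    linarith
  refine ⟨fun ε hε A hA => ⟨(integrable_secondVarIntegrand_iff (by omega) lam hA.1).mpr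
    (integrable_forms hn hlam hlam' hε hA).1, memLp_Mplus (by omega) hε hA,
    memLp_Mminus (by omega) hε hA, integrable_sphereFormIntegrand hn hlam hlam' hε hA⟩,
    fun δ hδ => ?_, fun h2 => ?_⟩
  · -- Any exponent `a ≤ 2` with `n - lam + a < n - 1` makes the kernel integrable on the sphere.
    let a : ℝ := min ((lam - 1) / 2) 1
    have ha : 0 < a := lt_min (by linarith) one_pos
    have ha1 : a ≤ (lam - 1) / 2 := min_le_left _ _
    have ha2 : a ≤ 1 := min_le_right _ _
    obtain ⟨C, hC0, hC⟩ := exists_lintegral_dist_rpow_le hn (q := n - lam + a) (by linarith)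
      (by linarith)
    have hlim : Filter.Tendsto (fun ε : ℝ => C₁ * ε + C₂ * (ε ^ a * C)) (nhdsWithin 0 (Set.Ioi 0))
        (nhds 0) := by
      have hcont : ContinuousAt (fun ε : ℝ => C₁ * ε + C₂ * (ε ^ a * C)) 0 := by
        have := Real.continuousAt_rpow_const 0 a (.inr ha.le)
        fun_prop
      have h0 := hcont.tendsto
      simp only [Real.zero_rpow ha.ne', mul_zero, zero_mul, add_zero] at h0
      exact h0.mono_left nhdsWithin_le_nhds
    obtain ⟨ε₁, hε₁, hlt⟩ := mem_nhdsGT_iff_exists_Ioo_subset.mp (hlim.eventually_lt_const hδ)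
    refine ⟨min ε₁ (1 / (n - lam)), lt_min hε₁ (by positivity), fun ε hε hεlt A hA => ?_⟩
    have hδ' : C₁ * ε + C₂ * (ε ^ a * C) < δ := hlt ⟨hε, hεlt.trans_le (min_le_left _ _)⟩
    refine (herr ε hε (hsmall ε (hεlt.trans_le (min_le_right _ _))) (ε ^ a * C) (by positivity)
      (fun ξ => ?_) A hA).trans (mul_le_mul_of_nonneg_right hδ'.le (by positivity))
    refine le_trans (lintegral_mono fun η => ENNReal.ofReal_le_ofReal ?_)
      (lintegral_ofReal_const_mul_le (g := fun t => t ^ (-((n : ℝ) - lam + a))) (by fun_prop)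
        (hC ξ) (by positivity : 0 ≤ ε ^ a))
    rcases (dist_nonneg (x := ξ) (y := η)).eq_or_lt with h0 | h0
    · rw [← h0, Real.zero_rpow (by linarith), zero_mul]
      positivity
    · have h1 := min_one_sq_le_rpow (y := ε / dist ξ η) (by positivity) ha.le (by linarith)
      rw [div_pow, Real.div_rpow hε.le h0.le] at h1
      calc dist ξ η ^ (-((n : ℝ) - lam)) * min 1 (ε ^ 2 / dist ξ η ^ 2)
          ≤ dist ξ η ^ (-((n : ℝ) - lam)) * (ε ^ a / dist ξ η ^ a) := by gcongr
        _ = ε ^ a * dist ξ η ^ (-((n : ℝ) - lam + a)) := by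
            rw [neg_add, Real.rpow_add h0, Real.rpow_neg h0.le a]
            ring
  · subst h2
    have hn1 : (0 : ℝ) < n - 1 := by linarith
    refine ⟨C₁ + C₂ * (n * 2 ^ n * (n - 1) * 2) + 1, 1 / (n - 2), by positivity, by positivity,
      fun ε hε hεlt A hA => ?_⟩
    refine (herr ε hε (hsmall ε hεlt) (n * 2 ^ n * (n - 1) * (2 * ε)) (by positivity)
      (fun ξ => lintegral_dist_rpow_mul_min_le hn hε ξ) A hA).trans ?_
    gcongr
    linarith
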